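/- **Setting.** Let $n\ge 0$ be an integer and $\beta\in\mathbb{R}$, and let $(\sigma(1),\ldots,\sigma(n))\in\{\pm1\}^n$ be a random spin configuration of the one-dimensional Ising model on $n$ sites with zero external field and free boundary, that is, $$\mathbb{P}[\sigma]=\frac{1}{Z_n}\exp\Big(\beta\sum_{i=1}^{n-1}\sigma(i)\sigma(i+1)\Big),$$ where $Z_n$ is the normalising constant. Put $x=\tanh\beta$. The joint cumulant of $m\ge 1$ bounded random variables is $$\kappa(X_1,\ldots,X_m)=\sum_{\Pi}(-1)^{\ell(\Pi)-1}(\ell(\Pi)-1)!\prod_{A\in\Pi}\mathbb{E}\Big[\prod_{j\in A}X_j\Big],$$ where the sum is over all set partitions $\Pi$ of $\{1,\ldots,m\}$ and $\ell(\Pi)$ is the number of parts of $\Pi$. A Dyck path of length $2m$ is a sequence $\delta=(\delta_0,\ldots,\delta_{2m})$ of non-negative integers with $\delta_0=\delta_{2m}=0$ and $|\delta_k-\delta_{k-1}|=1$ for $1\le k\le 2m$. For $r\ge1$, let $\mathfrak{D}^*_{2r}$ be the set of Dyck paths of length $2r$ obtained from a Dyck path of length $2r-2$ by adding an ascending step before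 it and a descending step after it. To a Dyck path $\delta$ of length $2r$ one associates the non-crossing pairing $\nu(\delta)$ of $\{1,\ldots,2r\}$ obtained by reading the steps from left to right, the $k$-th step opening a bond at $k$ if it is ascending, and closing at $k$ the most recently opened bond that is still open if it is descending. **Theorem.** For every $r\ge 1$ and all indices $1\le i_1\le i_2\le\cdots\le i_{2r}\le n$, $$\kappa(\sigma(i_1),\ldots,\sigma(i_{2r}))=(-1)^{r-1}\sum_{\delta\in\mathfrak{D}^*_{2r}}\Big(\prod_{k=1}^{2r-1}\delta_k\Big)\,x^{\delta},\qquad x^{\delta}:=x^{\sum_{\{a<b\}\in\nu(\delta)}(i_b-i_a)},$$ with the convention $0^0=1$. -/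

import Mathlib

namespace IsingCumulant

open MeasureTheory

noncomputable section

/-! ### The one-dimensional Ising model on `n` sites -/

/-- Spin configurations on `n` sites; the unit group `ℤˣ` is the set of signs `{1, -1}`. -/
abbrev Config (n : ℕ) : Type := Fin n → ℤˣ

/-- The sigma-algebra on the signs, hence also the one on configurations, is the full one. -/
instance : MeasurableSingletonClass ℤˣ where
  measurableSet_singleton u :=
    ⟨{(u : ℤ)}, MeasurableSet.singleton _, by
      ext v
      simp [Units.ext_iff]⟩

/-- The spin at site `k`, as a real random variable on the space of configurations. -/
def spin {n : ℕ} (k : Fin n) (s : Config n) : ℝ := ((s k : ℤ) : ℝ)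

/-- The exponent `α ∑ₖ σ(k) + β ∑ₖ σ(k) σ(k+1)`, the second sum being over the pairs of
consecutive sites (free boundary conditions). -/
def energy (n : ℕ) (α β : ℝ) (s : Config n) : ℝ :=
  α * ∑ k : Fin n, spin k s
    + β * ∑ k : Fin n, if h : (k : ℕ) + 1 < n then spin k s * spin ⟨(k : ℕ) + 1, h⟩ s else 0

/-- The partition function. -/
def partitionFunction (n : ℕ) (α β : ℝ) : ℝ := ∑ s : Config n, Real.exp (energy n α β s)

theorem partitionFunction_pos (n : ℕ) (α β : ℝ) : 0 < partitionFunction n α β :=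
  Finset.sum_pos (fun _ _ => Real.exp_pos _) Finset.univ_nonempty

/-- The Ising law with field `α` and interaction `β`:
each configuration has probability `exp (energy) / Z`. -/
def isingPMF (n : ℕ) (α β : ℝ) : PMF (Config n) :=
  PMF.ofFintype
    (fun s => ENNReal.ofReal (Real.exp (energy n α β s) / partitionFunction n α β))
    (by
      rw [← ENNReal.ofReal_sum_of_nonneg
        (fun s _ => div_nonneg (Real.exp_pos _).le (partitionFunction_pos n α β).le),
        ← Finset.sum_div]
      have h := partitionFunction_pos n α β
      rw [show (∑ s : Config n, Real.exp (energy n α β s)) = partitionFunction n α β from rfl,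
        div_self h.ne', ENNReal.ofReal_one])

/-- The Ising probability measure. -/
def isingMeasure (n : ℕ) (α β : ℝ) : Measure (Config n) := (isingPMF n α β).toMeasure

instance (n : ℕ) (α β : ℝ) : IsProbabilityMeasure (isingMeasure n α β) :=
  PMF.toMeasure.isProbabilityMeasure (isingPMF n α β)

/-! ### Joint cumulants -/

/-- The joint cumulant of a finite (nonempty) family of random variables:
the sum over all set partitions `P` of the index set of
`(-1) ^ (ℓ(P) - 1) (ℓ(P) - 1)! ∏_{A ∈ P} E[∏_{j ∈ A} X_j]`, with `ℓ(P)` the number of parts. -/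
def jointCumulant {Ω : Type*} [MeasurableSpace Ω] (μ : Measure Ω) {ι : Type*} [Fintype ι]
    [DecidableEq ι] (X : ι → Ω → ℝ) : ℝ :=
  ∑ P : Finpartition (Finset.univ : Finset ι),
    (-1 : ℝ) ^ (P.parts.card - 1) * ((P.parts.card - 1).factorial : ℝ)
      * ∏ A ∈ P.parts, ∫ ω, ∏ j ∈ A, X j ω ∂μ

end

/-! ### Dyck paths and their non-crossing pairings -/

/-- The height `δ_k` of a Dyck path after `k` steps: number of ascending steps minus number of
descending steps (for a Dyck word the subtraction never truncates). -/
def height (δ : DyckWord) (k : ℕ) : ℕ :=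
  (δ.toList.take k).count DyckStep.U - (δ.toList.take k).count DyckStep.D

/-- Dyck paths of length `2 * m`. -/
def dyckPaths (m : ℕ) : Finset DyckWord :=
  (Finset.univ : Finset {p : DyckWord // p.semilength = m}).image Subtype.val

/-- For `r ≥ 1`: the Dyck paths of length `2 * r` obtained from the Dyck paths of length
`2 * r - 2` by adding an ascending step before and a descending step after. -/
def dyckStar (r : ℕ) : Finset DyckWord := (dyckPaths (r - 1)).image DyckWord.nest

/-- Reading the steps from left to right, an ascending step opens a bond at the current point and
a descending step closes, at the current point, the most recently opened bond that is still open.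
The arguments are the remaining steps, the current point and the stack of the open bonds (most
recent first); the last case does not occur when a Dyck word is read. -/
def bondsAux : List DyckStep → ℕ → List ℕ → List (ℕ × ℕ)
  | [], _, _ => []
  | DyckStep.U :: l, k, s => bondsAux l (k + 1) (k :: s)
  | DyckStep.D :: l, k, a :: s => (a, k) :: bondsAux l (k + 1) s
  | DyckStep.D :: l, k, [] => bondsAux l (k + 1) []

/-- The bonds `(a, b)`, `a < b`, of the non-crossing pairing of a Dyck path;
the points are numbered from `0`. -/
def bonds (δ : DyckWord) : List (ℕ × ℕ) := bondsAux δ.toList 0 []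

/-- The non-crossing pairing of a Dyck path of length `N`, as a set of pairs `(a, b)`, `a < b`,
of elements of `Fin N`. -/
def pairing (N : ℕ) (δ : DyckWord) : Finset (Fin N × Fin N) :=
  Finset.univ.filter fun e => ((e.1 : ℕ), (e.2 : ℕ)) ∈ bonds δ

/-- The sum of the lengths `i_b - i_a` of the bonds `{a < b}` of the pairing of `δ`, when the
points are placed at the sites `i` (for nondecreasing `i` the subtraction never truncates). -/
def totalLength {N n : ℕ} (i : Fin N → Fin n) (δ : DyckWord) : ℕ :=
  ∑ e ∈ pairing N δ, ((i e.2 : ℕ) - (i e.1 : ℕ))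

end IsingCumulant

/-! Write E(S) for the moment of the spins indexed by S. With a the least index, ∑ κ(a ∪ A) E(T \ A)
over A ⊆ T equals E(a ∪ T), and these equations determine all cumulants
(`sum_setCumulant_insert_mul`, `setCumulant_eq_of_recursion`). It therefore suffices that the signed
path sum solves them.

Summing out the spins one by one gives the moments: when the total number of spins is even, each
unit gap with an odd number p of spins on its left contributes x; otherwise the moment vanishes. On
the path side the sum of the bond lengths is the area under the path, so a unit gap at height h
contributes x^h. The factor (-1)^(r-1) ∏ δ_k is spread over the steps: each weighs the height it
reaches, with a minus sign if it descends, except that the last step weighs 1.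

Let C(h, p) be the convolution of path sums from height h with moments of left parity p. A gap
multiplies it by x^(h+p), so linear relations at constant h + p survive gaps. Two families are also
stable under reading a site (`convolution_identities`): C(1, 0) is the moment of parity 1, and (e+2)
C(e+2, 0) + (e+1) C(e+1, 1) = 0. The first one is the recursion for the path sum. -/

namespace IsingCumulant

open Finset

/-! ### The moment-cumulant recursion. -/

section Cumulant

variable {ι : Type*} [DecidableEq ι]

/-- The cumulant of a set function `M`, the sum being over the partitions of `S`. -/
noncomputable def setCumulant (M : Finset ι → ℝ) (S : Finset ι) : ℝ :=
  ∑ P : Finpartition S, (-1 : ℝ) ^ (P.parts.card - 1) * ((P.parts.card - 1).factorial : ℝ)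
    * ∏ A ∈ P.parts, M A

/-- The partition of `S \ B` obtained by removing a part `B` from a partition of `S`. -/
def removePart {S A B : Finset ι} (Q : Finpartition S) (hB : B ∈ Q.parts) (hA : S \ B = A) :
    Finpartition A where
  parts := Q.parts.erase B
  supIndep := Q.supIndep.subset (erase_subset _ _)
  sup_parts := by
    rw [← hA]
    ext x
    simp only [mem_sup, mem_erase, id_eq, mem_sdiff]
    constructor
    · rintro ⟨C, ⟨hne, hC⟩, hx⟩
      exact ⟨Q.subset hC hx, fun hxB => hne (Q.eq_of_mem_parts hC hB hx hxB)⟩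
    · rintro ⟨hx, hxB⟩
      obtain ⟨C, hC, hxC⟩ := Q.exists_mem hx
      exact ⟨C, ⟨fun h => hxB (h ▸ hxC), hC⟩, hxC⟩
  bot_notMem h := Q.bot_notMem (mem_of_mem_erase h)

/-- Adjoining T \ A as a new part is a bijection onto partitions of a ∪ T with a marked part
avoiding a; A ≠ T makes the new part nonempty. -/
theorem sum_sum_finpartition_insert {T : Finset ι} {a : ι} (ha : a ∉ T)
    (g : Finset ι → Finset (Finset ι) → ℝ) :
    ∑ A ∈ T.powerset.erase T, ∑ P : Finpartition (insert a A), g (T \ A) P.parts =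
      ∑ Q : Finpartition (insert a T), ∑ B ∈ Q.parts.erase (Q.part a), g B (Q.parts.erase B) := by
  rw [sum_sigma', sum_sigma']
  have key : ∀ A ∈ T.powerset.erase T, T \ A ≠ ⊥ ∧ Disjoint (insert a A) (T \ A) ∧
      insert a A ⊔ (T \ A) = insert a T := by
    intro A hA
    rw [mem_erase, mem_powerset] at hA
    refine ⟨fun h => hA.1 (hA.2.antisymm (sdiff_eq_empty_iff_subset.1 h)), ?_, ?_⟩
    · rw [disjoint_insert_left]
      exact ⟨fun h => ha (mem_sdiff.1 h).1, disjoint_sdiff⟩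
    · change insert a A ∪ (T \ A) = _
      rw [insert_union, union_sdiff_of_subset hA.2]
  have notMem : ∀ A ∈ T.powerset.erase T, ∀ P : Finpartition (insert a A), T \ A ∉ P.parts := by
    intro A hA P h
    obtain ⟨h1, h2, -⟩ := key A hA
    exact h1 (disjoint_self.1 (h2.mono_left (P.le h)))
  refine sum_bij
    (fun x hx => ⟨x.2.extend (key x.1 (mem_sigma.1 hx).1).1 (key x.1 (mem_sigma.1 hx).1).2.1
      (key x.1 (mem_sigma.1 hx).1).2.2, T \ x.1⟩) ?_ ?_ ?_ ?_
  · rintro ⟨A, P⟩ hx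
    simp only [mem_sigma, mem_univ, true_and, mem_erase]
    refine ⟨fun h => ?_, mem_insert_self _ _⟩
    have : a ∈ T \ A := by
      rw [h]; exact Finpartition.mem_part_self _ |>.2 (mem_insert_self _ _)
    exact ha (mem_sdiff.1 this).1
  · rintro ⟨A, P⟩ hx ⟨A', P'⟩ hx' h
    have hA : A ∈ _ := (mem_sigma.1 hx).1
    have hA' : A' ∈ _ := (mem_sigma.1 hx').1
    simp only [Sigma.mk.injEq, heq_eq_eq] at h
    obtain ⟨h1, h2⟩ := h
    have : A = A' := by
      rw [← Finset.sdiff_sdiff_eq_self (mem_powerset.1 (mem_of_mem_erase hA)), h2,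
        Finset.sdiff_sdiff_eq_self (mem_powerset.1 (mem_of_mem_erase hA'))]
    subst this
    have h3 := congrArg (fun Q => Q.parts.erase (T \ A)) h1
    simp only [Finpartition.extend_parts] at h3
    rw [erase_insert (notMem A hA P), erase_insert (notMem A hA P')] at h3
    rw [Finpartition.ext h3]
  · rintro ⟨Q, B⟩ h
    simp only [mem_sigma, mem_univ, true_and, mem_erase] at h
    obtain ⟨h1, h2⟩ := h
    have haB : a ∉ B := fun h => h1 (Q.part_eq_of_mem h2 h).symm
    have hBT : B ⊆ T := fun x hx => (mem_insert.1 (Q.subset h2 hx)).resolve_left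
      (fun h => haB (h ▸ hx))
    have hB : B.Nonempty := Q.nonempty_of_mem_parts h2
    have hA : T \ B ∈ T.powerset.erase T := by
      rw [mem_erase, mem_powerset]
      refine ⟨fun h => ?_, sdiff_subset⟩
      obtain ⟨x, hx⟩ := hB
      have : x ∈ T \ B := by rw [h]; exact hBT hx
      exact (mem_sdiff.1 this).2 hx
    refine ⟨⟨T \ B, removePart Q h2 (insert_sdiff_of_notMem _ haB)⟩,
      mem_sigma.2 ⟨hA, mem_univ _⟩, ?_⟩
    have e : T \ (T \ B) = B := Finset.sdiff_sdiff_eq_self hBT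
    simp only [Sigma.mk.injEq]
    refine ⟨Finpartition.ext ?_, heq_of_eq e⟩
    simp only [Finpartition.extend_parts, removePart, e, insert_erase h2]
  · rintro ⟨A, P⟩ hx
    simp only [Finpartition.extend_parts]
    rw [erase_insert (notMem A (mem_sigma.1 hx).1 P)]

/-- A partition with l ≥ 2 parts has l - 1 parts avoiding a. Their total coefficient (l-1)
(-1)^(l-2) (l-2)! cancels the (-1)^(l-1) (l-1)! coming from A = T, so only the one-part partition
survives. -/
theorem sum_setCumulant_insert_mul (M : Finset ι → ℝ) (hM : M ∅ = 1) {T : Finset ι} {a : ι}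
    (ha : a ∉ T) :
    ∑ A ∈ T.powerset, setCumulant M (insert a A) * M (T \ A) = M (insert a T) := by
  rw [← add_sum_erase _ _ (mem_powerset_self T), sdiff_self, bot_eq_empty]
  have h := sum_sum_finpartition_insert ha (fun B R =>
    (-1 : ℝ) ^ (R.card - 1) * ((R.card - 1).factorial : ℝ) * (∏ A ∈ R, M A) * M B)
  simp only [← sum_mul] at h
  change _ + ∑ A ∈ T.powerset.erase T, setCumulant M (insert a A) * M (T \ A) = _
  unfold setCumulant
  rw [h, hM, mul_one, ← sum_add_distrib]
  have step : ∀ Q : Finpartition (insert a T),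
      ((-1 : ℝ) ^ (Q.parts.card - 1) * ((Q.parts.card - 1).factorial : ℝ) * ∏ A ∈ Q.parts, M A) +
        ∑ B ∈ Q.parts.erase (Q.part a), (-1 : ℝ) ^ ((Q.parts.erase B).card - 1) *
          (((Q.parts.erase B).card - 1).factorial : ℝ) * (∏ A ∈ Q.parts.erase B, M A) * M B =
      if Q = Finpartition.indiscrete (insert_ne_empty a T) then M (insert a T) else 0 := by
    intro Q
    have hpa : Q.part a ∈ Q.parts := Q.part_mem.2 (mem_insert_self _ _)
    have e : ∀ B ∈ Q.parts.erase (Q.part a), (-1 : ℝ) ^ ((Q.parts.erase B).card - 1) *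
          (((Q.parts.erase B).card - 1).factorial : ℝ) * (∏ A ∈ Q.parts.erase B, M A) * M B =
        (-1 : ℝ) ^ (Q.parts.card - 1 - 1) * ((Q.parts.card - 1 - 1).factorial : ℝ) *
          ∏ A ∈ Q.parts, M A := by
      intro B hB
      have hB' := mem_of_mem_erase hB
      rw [card_erase_of_mem hB', mul_assoc, prod_erase_mul _ _ hB']
    rw [sum_congr rfl e, sum_const, card_erase_of_mem hpa, nsmul_eq_mul]
    have hpos : 0 < Q.parts.card := card_pos.2 ⟨_, hpa⟩
    obtain ⟨l, hl⟩ : ∃ l, Q.parts.card = l + 1 := ⟨_, (Nat.succ_pred_eq_of_pos hpos).symm⟩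
    rw [hl]
    rcases l with _ | l
    · obtain ⟨B, hB⟩ := card_eq_one.1 hl
      have hBe : B = insert a T := by
        have := Q.biUnion_parts
        rwa [hB, singleton_biUnion] at this
      have hQ : Q = Finpartition.indiscrete (insert_ne_empty a T) := by
        apply Finpartition.ext
        rw [hB, hBe]; rfl
      rw [if_pos hQ, hB, hBe]
      simp
    · rw [if_neg]
      · simp only [Nat.add_sub_cancel, Nat.factorial_succ, pow_succ]
        push_cast
        ring
      · rintro rfl
        simp at hl
  rw [sum_congr rfl fun Q _ => step Q]
  simp

end Cumulant

/-- The moment-cumulant recursion, rooted at the least element, determines the cumulants. -/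
theorem setCumulant_eq_of_recursion {ι : Type*} [LinearOrder ι] (M f : Finset ι → ℝ)
    (hM : M ∅ = 1)
    (hf : ∀ (a : ι) (T : Finset ι), (∀ b ∈ T, a < b) →
      ∑ A ∈ T.powerset, f (insert a A) * M (T \ A) = M (insert a T)) :
    ∀ (T : Finset ι) (a : ι), (∀ b ∈ T, a < b) → setCumulant M (insert a T) = f (insert a T) := by
  intro T
  induction T using Finset.strongInduction with
  | H T ih =>
    intro a ha
    have haT : a ∉ T := fun h => lt_irrefl _ (ha a h)
    have h := (sum_setCumulant_insert_mul M hM haT).trans (hf a T ha).symm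
    -- The term A = T has factor M ∅ = 1 and is the only one not covered by induction.
    rw [← add_sum_erase _ _ (mem_powerset_self T), ← add_sum_erase _ _ (mem_powerset_self T)] at h
    have e : ∀ A ∈ T.powerset.erase T, setCumulant M (insert a A) * M (T \ A) =
        f (insert a A) * M (T \ A) := by
      intro A hA
      rw [mem_erase, mem_powerset] at hA
      rw [ih A (hA.2.ssubset_of_ne hA.1) a fun b hb => ha b (hA.2 hb)]
    rw [sum_congr rfl e] at h
    simpa only [sdiff_self, bot_eq_empty, hM, mul_one, add_left_inj] using h

/-! ### Path sums solve the recursion. -/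

section Paths

/-- The factor of a spin product over a nondecreasing list of sites, read from the site `q` on,
when the number of spins already read has parity `p`: `x` to the power of the number of bonds
with an odd number of spins on the left, and `0` if the total number of spins is odd. -/
def moment (x : ℝ) : Bool → ℕ → List ℕ → ℝ
  | p, _, [] => if p then 0 else 1
  | p, q, a :: l => x ^ (p.toNat * (a - q)) * moment x (!p) a l

/-- The signed weight of a descending step from height `h`. -/
def downWeight (h : ℕ) : ℝ := if h = 1 then 1 else -((h : ℝ) - 1)

theorem downWeight_one : downWeight 1 = 1 := if_pos rfl

theorem downWeight_add_two (h : ℕ) : downWeight (h + 2) = -((h : ℝ) + 1) := by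
  rw [downWeight, if_neg (by omega)]
  push_cast
  ring

/-- The signed weighted sum over the paths that start at height `h` at the site `q`, have one
step at each site of the list and reach `0` at the last one for the first time. -/
def pathSum (x : ℝ) : ℕ → ℕ → List ℕ → ℝ
  | 0, _, [] => 1
  | 0, _, _ :: _ => 0
  | _ + 1, _, [] => 0
  | h + 1, q, a :: l => x ^ ((h + 1) * (a - q)) *
      (((h : ℝ) + 2) * pathSum x (h + 2) a l + downWeight (h + 1) * pathSum x h a l)

variable {ι : Type*} [LinearOrder ι]

/-- The sites of the elements of a set of indices, in increasing order of the indices. -/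
def sites (i : ι → ℕ) (S : Finset ι) : List ℕ := (S.sort (· ≤ ·)).map i

theorem sites_empty (i : ι → ℕ) : sites i ∅ = [] := by simp [sites]

theorem sites_insert (i : ι → ℕ) {S : Finset ι} {a : ι} (ha : ∀ b ∈ S, a < b) :
    sites i (insert a S) = i a :: sites i S := by
  rw [sites, sort_insert _ (fun b hb => (ha b hb).le) fun h => lt_irrefl _ (ha a h), List.map_cons]
  rfl

/-- The sum over `A ⊆ S` of path sums over `A` times moment factors over `S \ A`. -/
def convolution (x : ℝ) (i : ι → ℕ) (h : ℕ) (p : Bool) (q : ℕ) (S : Finset ι) : ℝ :=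
  ∑ A ∈ S.powerset, pathSum x h q (sites i A) * moment x p q (sites i (S \ A))

theorem convolution_empty (x : ℝ) (i : ι → ℕ) (h : ℕ) (p : Bool) (q : ℕ) :
    convolution x i (h + 1) p q ∅ = 0 := by
  simp [convolution, sites_empty, pathSum]

theorem convolution_zero (x : ℝ) (i : ι → ℕ) (p : Bool) (q : ℕ) (S : Finset ι) :
    convolution x i 0 p q S = moment x p q (sites i S) := by
  unfold convolution
  rw [sum_eq_single ∅]
  · simp [sites_empty, pathSum]
  · intro A _ hA
    have : sites i A ≠ [] := by
      simp only [sites, ne_eq, List.map_eq_nil_iff]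
      intro h
      apply hA
      rw [← sort_toFinset A (· ≤ ·), h, List.toFinset_nil]
    obtain ⟨b, l, hl⟩ := List.exists_cons_of_ne_nil this
    rw [hl, pathSum, zero_mul]
  · simp

theorem pathSum_congr_start {x : ℝ} (h : ℕ) {q a : ℕ} (hqa : q ≤ a) :
    ∀ l : List ℕ, (∀ b ∈ l, a ≤ b) →
      pathSum x (h + 1) q l = x ^ ((h + 1) * (a - q)) * pathSum x (h + 1) a l
  | [], _ => by simp [pathSum]
  | b :: l, hl => by
    have hb : a ≤ b := hl b (by simp)
    rw [pathSum, pathSum, ← mul_assoc, ← pow_add, ← mul_add,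
      add_comm (a - q), Nat.sub_add_sub_cancel hb hqa]

theorem moment_congr_start {x : ℝ} (p : Bool) {q a : ℕ} (hqa : q ≤ a) :
    ∀ l : List ℕ, (∀ b ∈ l, a ≤ b) →
      moment x p q l = x ^ (p.toNat * (a - q)) * moment x p a l
  | [], _ => by cases p <;> simp [moment]
  | b :: l, hl => by
    have hb : a ≤ b := hl b (by simp)
    rw [moment, moment, ← mul_assoc, ← pow_add, ← mul_add,
      add_comm (a - q), Nat.sub_add_sub_cancel hb hqa]

/-- The least index a either goes to the path, as an ascent or a descent, or to the moment, where it
flips the parity. In each case the gap from q to the site of a costs x^(height + parity) per unit.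
-/
theorem convolution_insert (x : ℝ) {i : ι → ℕ} (hi : Monotone i) (h : ℕ) (p : Bool) {q : ℕ}
    {S : Finset ι} {a : ι} (ha : ∀ b ∈ S, a < b) (hq : q ≤ i a) :
    convolution x i (h + 1) p q (insert a S) = x ^ ((h + 1 + p.toNat) * (i a - q)) *
      (((h : ℝ) + 2) * convolution x i (h + 2) p (i a) S
        + downWeight (h + 1) * convolution x i h p (i a) S
        + convolution x i (h + 1) (!p) (i a) S) := by
  have haS : a ∉ S := fun h => lt_irrefl _ (ha a h)
  have hs : ∀ A ⊆ S, ∀ b ∈ sites i A, i a ≤ b := by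
    intro A hA b hb
    simp only [sites, List.mem_map, mem_sort] at hb
    obtain ⟨c, hc, rfl⟩ := hb
    exact hi (ha c (hA hc)).le
  unfold convolution
  rw [sum_powerset_insert haS, add_comm, mul_sum, mul_sum, ← sum_add_distrib, ← sum_add_distrib,
    ← sum_add_distrib, mul_sum]
  refine sum_congr rfl fun A hA => ?_
  have hA := mem_powerset.1 hA
  have haA : a ∉ A := fun h => haS (hA h)
  rw [insert_sdiff_of_notMem _ haA, insert_sdiff_insert, sdiff_insert_of_notMem haS,
    sites_insert i fun b hb => ha b (hA hb), sites_insert i fun b hb => ha b (sdiff_subset hb),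
    pathSum_congr_start h hq _ (hs A hA), moment_congr_start p hq _ (hs (S \ A) sdiff_subset),
    pathSum, moment, add_mul, pow_add]
  ring

/-- Neither family closes alone: the first needs the second at e = 0, and the second at e needs
itself at e + 1 and e - 1, with the first in place of e - 1 when e = 0. -/
theorem convolution_identities (x : ℝ) {i : ι → ℕ} (hi : Monotone i) (S : Finset ι) :
    ∀ q : ℕ, (∀ b ∈ S, q ≤ i b) →
      convolution x i 1 false q S = moment x true q (sites i S) ∧
      ∀ e : ℕ, ((e : ℝ) + 2) * convolution x i (e + 2) false q S
        + ((e : ℝ) + 1) * convolution x i (e + 1) true q S = 0 := by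
  induction S using Finset.induction_on_min with
  | empty => intro q _; simp [convolution_empty, sites_empty, moment]
  | insert a S ha ih =>
    intro q hq
    have hqa := hq a (mem_insert_self a S)
    obtain ⟨ih1, ih2⟩ := ih (i a) fun b hb => hi (ha b hb).le
    constructor
    · have h0 := ih2 0
      rw [convolution_insert x hi 0 false ha hqa, sites_insert i ha, moment, convolution_zero]
      norm_num [downWeight] at h0 ⊢
      left
      linarith
    · intro e
      rw [convolution_insert x hi (e + 1) false ha hqa, convolution_insert x hi e true ha hqa]
      have h2 := ih2 (e + 1)
      -- For e = 0 the descent from height 1 ends the path; its weight 1, instead of the value 0 of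
      -- the general formula, brings in the moment of parity 1.
      rcases e with _ | e
      · rw [downWeight_one, downWeight_add_two, convolution_zero]
        push_cast at h2 ⊢
        norm_num at h2 ⊢
        linear_combination 2 * x ^ (2 * (i a - q)) * h2 - x ^ (2 * (i a - q)) * ih1
      · have h1 := ih2 e
        rw [downWeight_add_two, downWeight_add_two,
          show e + 1 + 1 + 1 + false.toNat = e + 3 from rfl,
          show e + 1 + 1 + true.toNat = e + 3 from rfl, Bool.not_false, Bool.not_true]
        push_cast at h1 h2 ⊢
        linear_combination (e + 3) * x ^ ((e + 3) * (i a - q)) * h2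
          - (e + 2) * x ^ ((e + 3) * (i a - q)) * h1

/-- The signed weighted sum over the paths with one step at each site of a nonempty list, the
first one ascending, that return to `0` only at the last site. -/
def excursionSum (x : ℝ) : List ℕ → ℝ
  | [] => 0
  | a :: l => pathSum x 1 a l

theorem sum_excursionSum_mul_moment (x : ℝ) {i : ι → ℕ} (hi : Monotone i) (a : ι) (T : Finset ι)
    (ha : ∀ b ∈ T, a < b) :
    ∑ A ∈ T.powerset, excursionSum x (sites i (insert a A)) * moment x false 0 (sites i (T \ A)) =
      moment x false 0 (sites i (insert a T)) := by
  rw [sites_insert i ha, moment]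
  have h := (convolution_identities x hi T (i a) fun b hb => hi (ha b hb).le).1
  simp only [Bool.toNat_false, zero_mul, pow_zero, one_mul, Bool.not_false]
  rw [← h, convolution]
  refine sum_congr rfl fun A hA => ?_
  have hA := mem_powerset.1 hA
  rw [sites_insert i fun b hb => ha b (hA hb), excursionSum,
    moment_congr_start false (Nat.zero_le (i a))]
  · simp
  · intro b hb
    simp only [sites, List.mem_map, mem_sort] at hb
    obtain ⟨c, hc, rfl⟩ := hb
    exact hi (ha c (sdiff_subset hc)).le

end Paths

/-! ### Spin moments by summing out the chain. -/

section Moments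

/-- The interaction of a configuration whose first site has a left neighbour with spin `u`. -/
def chain : (n : ℕ) → ℝ → Config n → ℝ
  | 0, _, _ => 0
  | n + 1, u, s => u * spin 0 s + chain n (spin 0 s) (Fin.tail s)

theorem energy_succ (n : ℕ) (β : ℝ) (s : Config (n + 1)) :
    energy (n + 1) 0 β s = β * chain n (spin 0 s) (Fin.tail s) := by
  unfold energy
  rw [zero_mul, zero_add]
  congr 1
  induction n with
  | zero => simp [chain]
  | succ n ih =>
    rw [Fin.sum_univ_succ, chain, ← ih (Fin.tail s)]
    congr 1
    refine sum_congr rfl fun k _ => ?_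
    by_cases h : (k : ℕ) + 1 < n + 1
    · rw [dif_pos h, dif_pos (by simpa using h)]
      rfl
    · rw [dif_neg h, dif_neg (by simpa using h)]

theorem sum_config_succ {n : ℕ} (f : Config (n + 1) → ℝ) :
    ∑ s, f s = ∑ v : ℤˣ, ∑ t : Config n, f (Fin.cons v t) := by
  rw [← Fintype.sum_prod_type' fun (v : ℤˣ) (t : Config n) => f (Fin.cons v t)]
  exact (Fintype.sum_equiv (Fin.consEquiv fun _ => ℤˣ) _ _ fun _ => rfl).symm

theorem sum_units_exp (β : ℝ) (u : ℤˣ) (m : ℕ) :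
    ∑ v : ℤˣ, ((v : ℤ) : ℝ) ^ m * Real.exp (β * (((u : ℤ) : ℝ) * ((v : ℤ) : ℝ))) =
      2 * Real.cosh β * ((u : ℤ) : ℝ) ^ m * Real.tanh β ^ (m % 2) := by
  have hc : Real.cosh β ≠ 0 := (Real.cosh_pos β).ne'
  rw [UnitsInt.univ, sum_pair (by decide)]
  rcases Int.units_eq_one_or u with rfl | rfl <;> rcases Nat.even_or_odd m with hm | hm
  all_goals
    simp [hm.neg_one_pow, Real.tanh_eq_sinh_div_cosh, Nat.even_iff.1, Nat.odd_iff.1, hm]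
    try field_simp
    first | rw [Real.cosh_eq] | rw [Real.sinh_eq]
    ring

/-- By `sum_units_exp`, summing out a spin raised to m transfers the power m to its left neighbour
at the cost of 2 cosh β, and of tanh β if m is odd; m accumulates all exponents on the right. -/
theorem sum_config_chain (β : ℝ) : ∀ (n : ℕ) (u : ℤˣ) (c : Fin n → ℕ),
    ∑ s : Config n, (∏ k, spin k s ^ c k) * Real.exp (β * chain n ((u : ℤ) : ℝ) s) =
      (2 * Real.cosh β) ^ n * ((u : ℤ) : ℝ) ^ (∑ k, c k) *
        ∏ k, Real.tanh β ^ ((∑ l, if k ≤ l then c l else 0) % 2)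
  | 0, u, c => by simp [chain]
  | n + 1, u, c => by
    rw [sum_config_succ]
    have step : ∀ v : ℤˣ, ∑ t : Config n, (∏ k, spin k (Fin.cons v t : Config (n + 1)) ^ c k) *
        Real.exp (β * chain (n + 1) ((u : ℤ) : ℝ) (Fin.cons v t)) =
        ((v : ℤ) : ℝ) ^ (∑ k, c k) * Real.exp (β * (((u : ℤ) : ℝ) * ((v : ℤ) : ℝ))) *
        ((2 * Real.cosh β) ^ n *
          ∏ k : Fin n, Real.tanh β ^ ((∑ l, if k ≤ l then c l.succ else 0) % 2)) := by
      intro v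
      have ih := sum_config_chain β n v fun k => c k.succ
      have e : ∀ t : Config n, (∏ k, spin k (Fin.cons v t : Config (n + 1)) ^ c k) *
          Real.exp (β * chain (n + 1) ((u : ℤ) : ℝ) (Fin.cons v t)) =
          ((v : ℤ) : ℝ) ^ c 0 * Real.exp (β * (((u : ℤ) : ℝ) * ((v : ℤ) : ℝ))) *
          ((∏ k, spin k t ^ c k.succ) * Real.exp (β * chain n ((v : ℤ) : ℝ) t)) := by
        intro t
        rw [Fin.prod_univ_succ, chain, mul_add, Real.exp_add]
        simp only [spin, Fin.cons_zero, Fin.cons_succ, Fin.tail_cons]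
        ring
      rw [sum_congr rfl fun t _ => e t, ← mul_sum, ih, Fin.sum_univ_succ, pow_add]
      ring
    rw [sum_congr rfl fun v _ => step v, ← sum_mul, sum_units_exp, Fin.prod_univ_succ]
    have : ∀ k : Fin n, ¬ k.succ ≤ 0 := fun k => by simp
    have h2 : ∀ k : Fin n, (∑ l, if k.succ ≤ l then c l else 0) =
        ∑ l, if k ≤ l then c l.succ else 0 := fun k => by
      rw [Fin.sum_univ_succ]
      simp [this]
    simp only [Fin.zero_le, if_true, h2]
    ring

theorem sum_config_energy (β : ℝ) (n : ℕ) (c : Fin (n + 1) → ℕ) :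
    ∑ s, (∏ k, spin k s ^ c k) * Real.exp (energy (n + 1) 0 β s) =
      (2 * Real.cosh β) ^ n * (1 + (-1) ^ ∑ k, c k) *
        ∏ k : Fin n, Real.tanh β ^ ((∑ l, if k.succ ≤ l then c l else 0) % 2) := by
  rw [sum_config_succ]
  have step : ∀ v : ℤˣ, ∑ t : Config n, (∏ k, spin k (Fin.cons v t : Config (n + 1)) ^ c k) *
      Real.exp (energy (n + 1) 0 β (Fin.cons v t)) = ((v : ℤ) : ℝ) ^ (∑ k, c k) *
      ((2 * Real.cosh β) ^ n *
        ∏ k : Fin n, Real.tanh β ^ ((∑ l, if k ≤ l then c l.succ else 0) % 2)) := by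
    intro v
    have e : ∀ t : Config n, (∏ k, spin k (Fin.cons v t : Config (n + 1)) ^ c k) *
        Real.exp (energy (n + 1) 0 β (Fin.cons v t)) = ((v : ℤ) : ℝ) ^ c 0 *
        ((∏ k, spin k t ^ c k.succ) * Real.exp (β * chain n ((v : ℤ) : ℝ) t)) := by
      intro t
      rw [Fin.prod_univ_succ, energy_succ]
      simp only [spin, Fin.cons_zero, Fin.cons_succ, Fin.tail_cons]
      ring
    rw [sum_congr rfl fun t _ => e t, ← mul_sum, sum_config_chain β n v fun k => c k.succ,
      Fin.sum_univ_succ, pow_add]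
    ring
  rw [sum_congr rfl fun v _ => step v, ← sum_mul, UnitsInt.univ, sum_pair (by decide)]
  have : ∀ k : Fin n, ¬ k.succ ≤ 0 := fun k => by simp
  have h2 : ∀ k : Fin n, (∑ l, if k.succ ≤ l then c l else 0) =
      ∑ l, if k ≤ l then c l.succ else 0 := fun k => by
    rw [Fin.sum_univ_succ]
    simp [this]
  simp only [h2]
  push_cast
  rw [one_pow]
  ring

/-- Moments of the spins: with `t k` the number of spins at the site `k` or to its right,
each odd `t k` contributes a factor `tanh β`. -/
theorem integral_prod_spin {n : ℕ} {ι : Type*} (β : ℝ) (i : ι → Fin n) (S : Finset ι) :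
    ∫ s, ∏ j ∈ S, spin (i j) s ∂(isingMeasure n 0 β) =
      if Even S.card then
        ∏ k ∈ Ico 1 n, Real.tanh β ^ ((S.filter fun j => k ≤ (i j : ℕ)).card % 2) else 0 := by
  classical
  rw [isingMeasure, PMF.integral_eq_sum]
  have hw : ∀ s, (isingPMF n 0 β s).toReal = Real.exp (energy n 0 β s) / partitionFunction n 0 β :=
    fun s => by
      rw [isingPMF, PMF.ofFintype_apply, ENNReal.toReal_ofReal]
      exact div_nonneg (Real.exp_pos _).le (partitionFunction_pos n 0 β).le
  rcases n with _ | n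
  · have hS : S = ∅ := eq_empty_of_forall_notMem fun j _ => (i j).elim0
    subst hS
    simp [hw, partitionFunction]
  set c : Fin (n + 1) → ℕ := fun k => (S.filter fun j => i j = k).card with hc
  have hprod : ∀ s : Config (n + 1), ∏ j ∈ S, spin (i j) s = ∏ k, spin k s ^ c k := by
    intro s
    rw [← prod_fiberwise' S i fun k => spin k s]
    simp [hc]
  have hcount : ∀ k : Fin (n + 1), (∑ l, if k ≤ l then c l else 0) =
      (S.filter fun j => (k : ℕ) ≤ (i j : ℕ)).card := by
    intro k
    rw [card_eq_sum_card_fiberwise (f := i) (t := univ) fun _ _ => by simp]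
    refine sum_congr rfl fun l _ => ?_
    rw [filter_filter]
    split_ifs with h
    · simp only [hc]
      congr 1
      ext j
      simp only [mem_filter, Fin.val_fin_le]
      constructor
      · rintro ⟨h1, rfl⟩; exact ⟨h1, h, rfl⟩
      · rintro ⟨h1, -, h2⟩; exact ⟨h1, h2⟩
    · symm
      rw [card_eq_zero, filter_eq_empty_iff]
      rintro j - ⟨h1, rfl⟩
      exact h (Fin.val_fin_le.1 h1)
  have htotal : ∑ k, c k = S.card := by
    rw [card_eq_sum_card_fiberwise (f := i) (t := univ) fun _ _ => by simp]
  -- The partition function is the case of zero exponents.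
  have hZ : partitionFunction (n + 1) 0 β = 2 * (2 * Real.cosh β) ^ n := by
    have := sum_config_energy β n fun _ => 0
    simp only [pow_zero, prod_const_one, one_mul, ite_self, sum_const_zero, Nat.zero_mod] at this
    rw [partitionFunction, this]
    ring
  have hpow : (2 * Real.cosh β) ^ n ≠ 0 := pow_ne_zero _ (by have := Real.cosh_pos β; positivity)
  have hsum := sum_config_energy β n c
  have : ∑ s, (isingPMF (n + 1) 0 β s).toReal • ∏ j ∈ S, spin (i j) s =
      (∑ s, (∏ k, spin k s ^ c k) * Real.exp (energy (n + 1) 0 β s)) /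
        partitionFunction (n + 1) 0 β := by
    rw [sum_div]
    refine sum_congr rfl fun s _ => ?_
    rw [hw, hprod, smul_eq_mul]
    ring
  rw [this, hsum, hZ, htotal]
  simp only [hcount]
  have hIco : ∏ k ∈ Ico 1 (n + 1), Real.tanh β ^ ((S.filter fun j => k ≤ (i j : ℕ)).card % 2) =
      ∏ k : Fin n, Real.tanh β ^ ((S.filter fun j => (k.succ : ℕ) ≤ (i j : ℕ)).card % 2) := by
    rw [prod_Ico_eq_prod_range, prod_range]
    simp [add_comm]
  rw [hIco]
  split_ifs with h
  · rw [h.neg_one_pow]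
    field_simp
    ring
  · rw [(Nat.not_even_iff_odd.1 h).neg_one_pow]
    simp

theorem moment_eq_prod (x : ℝ) (n : ℕ) : ∀ (l : List ℕ) (p : Bool) (q : ℕ),
    l.Pairwise (· ≤ ·) → (∀ a ∈ l, q ≤ a ∧ a < n) →
    moment x p q l = if Even (p.toNat + l.length) then
      ∏ k ∈ Ico (q + 1) n, x ^ (l.countP (k ≤ ·) % 2) else 0
  | [], p, q, _, _ => by cases p <;> simp [moment]
  | a :: l, p, q, hl, h => by
    obtain ⟨hqa, han⟩ := h a (by simp)
    rw [List.pairwise_cons] at hl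
    rw [moment, moment_eq_prod x n l (!p) a hl.2 fun b hb => ⟨hl.1 b hb, (h b (by simp [hb])).2⟩]
    have hpar : Even ((!p).toNat + l.length) ↔ Even (p.toNat + (a :: l).length) := by
      cases p <;> simp [Nat.even_add_one, parity_simps]
    simp only [hpar]
    split_ifs with he
    · rw [← prod_Ico_consecutive _ (Nat.succ_le_succ hqa) han]
      congr 1
      · have : ∀ k ∈ Ico (q + 1) (a + 1), x ^ ((a :: l).countP (k ≤ ·) % 2) = x ^ p.toNat := by
          intro k hk
          have hka : k ≤ a := Nat.lt_succ_iff.1 (mem_Ico.1 hk).2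
          have : (a :: l).countP (k ≤ ·) = (a :: l).length := by
            rw [List.countP_eq_length]
            intro b hb
            rcases List.mem_cons.1 hb with rfl | hb
            · simpa using hka
            · simpa using hka.trans (hl.1 b hb)
          rw [this]
          congr 1
          rcases p <;> simp only [Bool.toNat_true, Bool.toNat_false] at he ⊢ <;>
            rw [Nat.even_iff] at he <;> omega
        rw [prod_congr rfl this, prod_const, Nat.card_Ico, ← pow_mul]
        congr 2
        omega
      · refine prod_congr rfl fun k hk => ?_
        have hka : ¬ k ≤ a := by have := (mem_Ico.1 hk).1; omega
        simp [hka]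
    · simp

theorem integral_prod_spin_eq_moment {n : ℕ} {ι : Type*} [LinearOrder ι] (β : ℝ) {i : ι → Fin n}
    (hi : Monotone i) (S : Finset ι) :
    ∫ s, ∏ j ∈ S, spin (i j) s ∂(isingMeasure n 0 β) =
      moment (Real.tanh β) false 0 (sites (fun j => (i j : ℕ)) S) := by
  rw [integral_prod_spin, moment_eq_prod _ n]
  · have hlen : (sites (fun j => (i j : ℕ)) S).length = S.card := by simp [sites]
    have hcount : ∀ k : ℕ, (sites (fun j => (i j : ℕ)) S).countP (k ≤ ·) =
        (S.filter fun j => k ≤ (i j : ℕ)).card := by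
      intro k
      rw [sites, List.countP_map]
      change (S.sort (· ≤ ·)).countP (fun j => decide (k ≤ (i j : ℕ))) = _
      rw [← Multiset.coe_countP, sort_eq, Multiset.countP_eq_card_filter]
      rfl
    simp [hlen, hcount]
  · rw [sites, List.pairwise_map]
    exact (pairwise_sort S (· ≤ ·)).imp fun h => hi h
  · intro a ha
    simp only [sites, List.mem_map] at ha
    obtain ⟨j, -, rfl⟩ := ha
    exact ⟨Nat.zero_le _, (i j).2⟩

/-- The joint cumulant of spins at nondecreasing sites is a signed sum over paths. -/
theorem jointCumulant_spin_eq_excursionSum {n N : ℕ} (hN : 0 < N) (β : ℝ) {i : Fin N → Fin n}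
    (hi : Monotone i) :
    jointCumulant (isingMeasure n 0 β) (fun j : Fin N => spin (i j)) =
      excursionSum (Real.tanh β) ((List.finRange N).map fun j => (i j : ℕ)) := by
  have hi' : Monotone fun j => (i j : ℕ) := fun a b h => hi h
  have h := setCumulant_eq_of_recursion
    (fun S => ∫ s, ∏ j ∈ S, spin (i j) s ∂(isingMeasure n 0 β))
    (fun S => excursionSum (Real.tanh β) (sites (fun j => (i j : ℕ)) S)) (by simp)
    (fun a T ha => by
      simp only [integral_prod_spin_eq_moment β hi]
      exact sum_excursionSum_mul_moment (Real.tanh β) hi' a T ha)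
    (univ.erase ⟨0, hN⟩) ⟨0, hN⟩ fun b hb =>
      Nat.pos_of_ne_zero fun h => ne_of_mem_erase hb (Fin.ext h)
  rw [insert_erase (mem_univ _)] at h
  rw [← Fin.sort_univ]
  exact h

end Moments

/-! ### From path sums to Dyck words: weights, heights and bond lengths. -/

section Excursions

/-- The height after a step from the height `h`. -/
def nextHeight (h : ℕ) : DyckStep → ℕ
  | DyckStep.U => h + 1
  | DyckStep.D => h - 1

/-- The signed weight of a step from the height `h`. -/
def stepWeight (h : ℕ) : DyckStep → ℝ
  | DyckStep.U => (h : ℝ) + 1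
  | DyckStep.D => downWeight h

/-- The step sequences of length `n` from the height `h` that reach `0` exactly at their end. -/
def descents : ℕ → ℕ → Finset (List DyckStep)
  | 0, 0 => {[]}
  | _ + 1, 0 => ∅
  | 0, _ + 1 => ∅
  | h + 1, n + 1 => (descents (h + 2) n).image (List.cons DyckStep.U) ∪
      (descents h n).image (List.cons DyckStep.D)

theorem mem_descents_succ {h n : ℕ} {s : List DyckStep} :
    s ∈ descents (h + 1) (n + 1) ↔
      ∃ c t, s = c :: t ∧ t ∈ descents (nextHeight (h + 1) c) n := by
  rw [descents, mem_union, mem_image, mem_image]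
  constructor
  · rintro (⟨t, ht, rfl⟩ | ⟨t, ht, rfl⟩)
    · exact ⟨_, t, rfl, ht⟩
    · exact ⟨_, t, rfl, ht⟩
  · rintro ⟨c, t, rfl, ht⟩
    cases c
    · exact Or.inl ⟨t, ht, rfl⟩
    · exact Or.inr ⟨t, ht, rfl⟩

theorem mem_descents_zero {n : ℕ} {s : List DyckStep} :
    s ∈ descents 0 n ↔ n = 0 ∧ s = [] := by
  cases n <;> simp [descents]

theorem length_of_mem_descents : ∀ {n h : ℕ} {s : List DyckStep}, s ∈ descents h n → s.length = n
  | 0, 0, s, hs => by simpa [descents] using hs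
  | 0, h + 1, s, hs => by simp [descents] at hs
  | n + 1, 0, s, hs => by simp [descents] at hs
  | n + 1, h + 1, s, hs => by
    obtain ⟨c, t, rfl, ht⟩ := mem_descents_succ.1 hs
    simp [length_of_mem_descents ht]

/-- The signed weight of a step sequence from the height `h`. -/
def stepsWeight : ℕ → List DyckStep → ℝ
  | _, [] => 1
  | h, c :: s => stepWeight h c * stepsWeight (nextHeight h c) s

/-- The area under a step sequence from the height `h` at the site `q`, with steps at `l`. -/
def area : ℕ → ℕ → List DyckStep → List ℕ → ℕ
  | h, q, c :: s, a :: l => h * (a - q) + area (nextHeight h c) a s l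
  | _, _, _, _ => 0

theorem pathSum_eq_sum_descents (x : ℝ) : ∀ (l : List ℕ) (h q : ℕ),
    pathSum x h q l =
      ∑ s ∈ descents h l.length, stepsWeight h s * x ^ area h q s l
  | [], 0, q => by simp [pathSum, descents, stepsWeight, area]
  | [], h + 1, q => by simp [pathSum, descents]
  | a :: l, 0, q => by simp [pathSum, descents]
  | a :: l, h + 1, q => by
    rw [pathSum, List.length_cons, descents, sum_union, sum_image, sum_image,
      pathSum_eq_sum_descents x l, pathSum_eq_sum_descents x l, mul_add, mul_sum, mul_sum, mul_sum,
      mul_sum]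
    · congr 1
      · refine sum_congr rfl fun s _ => ?_
        simp only [stepsWeight, area, stepWeight, nextHeight, pow_add]
        push_cast
        ring
      · refine sum_congr rfl fun s _ => ?_
        simp only [stepsWeight, area, stepWeight, nextHeight, pow_add, Nat.add_sub_cancel]
        ring
    · exact fun s _ t _ h => (List.cons.inj h).2
    · exact fun s _ t _ h => (List.cons.inj h).2
    · rw [disjoint_left]
      intro s h1 h2
      obtain ⟨t, -, rfl⟩ := mem_image.1 h1
      obtain ⟨t', -, h3⟩ := mem_image.1 h2
      simp at h3

/-- The height after `k` steps of a step sequence that starts at the height `h`. -/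
def heightFrom (h : ℕ) (s : List DyckStep) (k : ℕ) : ℕ :=
  h + (s.take k).count DyckStep.U - (s.take k).count DyckStep.D

theorem heightFrom_cons {h : ℕ} (hh : 0 < h) (c : DyckStep) (s : List DyckStep) (k : ℕ) :
    heightFrom h (c :: s) (k + 1) = heightFrom (nextHeight h c) s k := by
  cases c <;> simp [heightFrom, nextHeight] <;> omega

/-- Weights record the heights reached, the product the heights left: hence the extra factor h + 1
for the starting height. The leading minus sign compensates for the unsigned last descent. -/
theorem stepsWeight_mul : ∀ {n h : ℕ} {s : List DyckStep}, s ∈ descents (h + 1) n →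
    stepsWeight (h + 1) s * ((h : ℝ) + 1) =
      -(-1) ^ s.count DyckStep.D * ∏ k ∈ range n, (heightFrom (h + 1) s k : ℝ)
  | 0, h, s, hs => by simp [descents] at hs
  | n + 1, h, s, hs => by
    obtain ⟨c, t, rfl, ht⟩ := mem_descents_succ.1 hs
    rw [prod_range_succ']
    simp only [heightFrom_cons (Nat.succ_pos h)]
    have h0 : heightFrom (h + 1) (c :: t) 0 = h + 1 := by simp [heightFrom]
    rw [h0, stepsWeight]
    cases c
    · have ih := stepsWeight_mul ht
      rw [List.count_cons_of_ne (by decide)]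
      simp only [nextHeight, stepWeight] at ih ⊢
      push_cast at ih ⊢
      linear_combination ((h : ℝ) + 1) * ih
    · rcases h with _ | h
      · obtain ⟨rfl, rfl⟩ := mem_descents_zero.1 ht
        simp [stepWeight, downWeight_one, stepsWeight]
      · have ih := stepsWeight_mul ht
        simp only [nextHeight, stepWeight, Nat.add_sub_cancel, downWeight_add_two,
          List.count_cons_self, pow_succ] at ih ⊢
        push_cast at ih ⊢
        linear_combination -((h : ℝ) + 1 + 1) * ih

/-- The last step goes from 1 to 0; what precedes stays at height at least 1. For h = 0 the
conditions on p are those of a Dyck word, which links `descents` to `DyckWord.nest`. -/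
theorem mem_descents_iff : ∀ {n h : ℕ} {s : List DyckStep}, s ∈ descents (h + 1) n ↔
    ∃ p : List DyckStep, s = p ++ [DyckStep.D] ∧ p.length + 1 = n ∧
      p.count DyckStep.U + h = p.count DyckStep.D ∧
      ∀ k, (p.take k).count DyckStep.D ≤ (p.take k).count DyckStep.U + h
  | 0, h, s => by simp [descents]
  | n + 1, h, s => by
    rw [mem_descents_succ]
    constructor
    · rintro ⟨c, t, rfl, ht⟩
      cases c
      · obtain ⟨p, rfl, h1, h2, h3⟩ := mem_descents_iff.1 ht
        refine ⟨DyckStep.U :: p, rfl, by simpa using h1, by simp; omega, fun k => ?_⟩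
        rcases k with _ | k
        · simp
        · have := h3 k
          simp
          omega
      · rcases h with _ | h
        · obtain ⟨rfl, rfl⟩ := mem_descents_zero.1 ht
          exact ⟨[], by simp⟩
        · obtain ⟨p, rfl, h1, h2, h3⟩ := mem_descents_iff.1 ht
          refine ⟨DyckStep.D :: p, rfl, by simpa using h1, by simp; omega, fun k => ?_⟩
          rcases k with _ | k
          · simp
          · have := h3 k
            simp
            omega
    · rintro ⟨p, rfl, h1, h2, h3⟩
      rcases p with _ | ⟨c, p⟩
      · have hh : h = 0 := by simpa using h2
        have hn : n = 0 := by simpa using h1.symm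
        subst hh hn
        exact ⟨DyckStep.D, [], rfl, by simp [nextHeight, descents]⟩
      · refine ⟨c, p ++ [DyckStep.D], rfl, ?_⟩
        cases c
        · refine mem_descents_iff.2 ⟨p, rfl, by simpa using h1, ?_, fun k => ?_⟩
          · simp at h2
            omega
          · have := h3 (k + 1)
            simp at this
            omega
        · rcases h with _ | h
          · have := h3 1
            simp at this
          · refine mem_descents_iff.2 ⟨p, rfl, by simpa using h1, ?_, fun k => ?_⟩
            · simp at h2
              omega
            · have := h3 (k + 1)
              simp at this
              omega

theorem mem_dyckStar {r : ℕ} {δ : DyckWord} :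
    δ ∈ dyckStar r ↔ ∃ p : DyckWord, p.semilength = r - 1 ∧ p.nest = δ := by
  simp [dyckStar, dyckPaths]

theorem sum_dyckStar {r : ℕ} (hr : 1 ≤ r) (F : List DyckStep → ℝ) :
    ∑ δ ∈ dyckStar r, F δ.toList = ∑ s ∈ descents 1 (2 * r - 1), F (DyckStep.U :: s) := by
  refine sum_bij (fun δ _ => δ.toList.tail) ?_ ?_ ?_ ?_
  · intro δ hδ
    obtain ⟨p, hp, rfl⟩ := mem_dyckStar.1 hδ
    have hl := p.two_mul_semilength_eq_length
    exact mem_descents_iff.2 ⟨p.toList, rfl, by omega, p.count_U_eq_count_D,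
      p.count_D_le_count_U⟩
  · intro δ hδ δ' hδ' h
    obtain ⟨p, hp, rfl⟩ := mem_dyckStar.1 hδ
    obtain ⟨p', hp', rfl⟩ := mem_dyckStar.1 hδ'
    have h' : p.toList ++ [DyckStep.D] = p'.toList ++ [DyckStep.D] := h
    rw [DyckWord.ext (List.append_cancel_right h')]
  · intro s hs
    obtain ⟨p, rfl, h1, h2, h3⟩ := mem_descents_iff.1 hs
    have hl := (⟨p, h2, h3⟩ : DyckWord).two_mul_semilength_eq_length
    refine ⟨(⟨p, h2, h3⟩ : DyckWord).nest, mem_dyckStar.2 ⟨_, ?_, rfl⟩, rfl⟩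
    change 2 * _ = p.length at hl
    omega
  · intro δ hδ
    obtain ⟨p, hp, rfl⟩ := mem_dyckStar.1 hδ
    rfl

theorem prod_height {r : ℕ} (hr : 1 ≤ r) {δ : DyckWord} {s : List DyckStep}
    (hs : s ∈ descents 1 (2 * r - 1)) (hδ : δ.toList = DyckStep.U :: s) :
    (-1 : ℝ) ^ (r - 1) * ∏ k ∈ Icc 1 (2 * r - 1), (height δ k : ℝ) = stepsWeight 1 s := by
  have h := stepsWeight_mul hs
  have hc : s.count DyckStep.D = r := by
    have h1 := δ.semilength_eq_count_D
    have h2 := δ.two_mul_semilength_eq_length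
    rw [hδ, List.count_cons_of_ne (by decide)] at h1
    rw [hδ, List.length_cons, length_of_mem_descents hs] at h2
    omega
  have hp : ∏ k ∈ Icc 1 (2 * r - 1), (height δ k : ℝ) =
      ∏ k ∈ range (2 * r - 1), (heightFrom 1 s k : ℝ) := by
    rw [← Ico_add_one_right_eq_Icc, prod_Ico_eq_prod_range]
    refine prod_congr rfl fun k _ => ?_
    rw [height, hδ, heightFrom, add_comm 1 k]
    simp [add_comm]
  obtain ⟨m, rfl⟩ : ∃ m, r = m + 1 := ⟨r - 1, by omega⟩
  rw [hp]
  rw [hc] at h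
  norm_num [pow_succ] at h
  rw [h]
  rfl

/-! ### Bonds and area -/

theorem mem_bondsAux : ∀ (s : List DyckStep) (k : ℕ) (st : List ℕ) (M : ℕ), (∀ a ∈ st, a < M) →
    k + s.length ≤ M → ∀ b ∈ bondsAux s k st, b.1 < M ∧ k ≤ b.2 ∧ b.2 < M
  | [], k, st, M, _, _ => by simp [bondsAux]
  | DyckStep.U :: s, k, st, M, hst, hM => by
    intro b hb
    rw [List.length_cons] at hM
    have := mem_bondsAux s (k + 1) (k :: st) M
      (by rintro a ha; rcases List.mem_cons.1 ha with rfl | ha; · omega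
          · exact hst a ha) (by omega) b hb
    omega
  | DyckStep.D :: s, k, [], M, hst, hM => by
    intro b hb
    rw [List.length_cons] at hM
    have := mem_bondsAux s (k + 1) [] M hst (by omega) b hb
    omega
  | DyckStep.D :: s, k, a :: st, M, hst, hM => by
    intro b hb
    rw [List.length_cons] at hM
    rw [bondsAux] at hb
    rcases List.mem_cons.1 hb with rfl | hb
    · exact ⟨hst a (by simp), le_rfl, by change k < M; omega⟩
    · have := mem_bondsAux s (k + 1) st M (fun c hc => hst c (by simp [hc])) (by omega) b hb
      omega

theorem le_snd_of_mem_bondsAux (s : List DyckStep) (k : ℕ) (st : List ℕ) :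
    ∀ b ∈ bondsAux s k st, k ≤ b.2 := fun b hb =>
  -- Any bound above the stack entries and the points to be read serves; the sum of the stack
  -- dominates each entry.
  (mem_bondsAux s k st (k + s.length + st.sum + 1)
    (fun a ha => by have := List.single_le_sum (fun _ _ => Nat.zero_le _) a ha; omega)
    (by omega) b hb).2.1

theorem nodup_bondsAux : ∀ (s : List DyckStep) (k : ℕ) (st : List ℕ), (bondsAux s k st).Nodup
  | [], k, st => by simp [bondsAux]
  | DyckStep.U :: s, k, st => nodup_bondsAux s (k + 1) (k :: st)
  | DyckStep.D :: s, k, [] => nodup_bondsAux s (k + 1) []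
  | DyckStep.D :: s, k, a :: st => by
    rw [bondsAux, List.nodup_cons]
    refine ⟨fun h => ?_, nodup_bondsAux s (k + 1) st⟩
    have := le_snd_of_mem_bondsAux _ _ _ _ h
    simp at this

theorem totalLength_eq_sum {N n : ℕ} (i : Fin N → Fin n) (δ : DyckWord) (hδ : δ.toList.length ≤ N)
    (pos : ℕ → ℕ) (hpos : ∀ j : Fin N, pos j = i j) :
    totalLength i δ = ((bonds δ).map fun b => pos b.2 - pos b.1).sum := by
  rw [bonds, ← List.sum_toFinset _ (nodup_bondsAux _ _ _), totalLength]
  refine sum_bij (fun e _ => ((e.1 : ℕ), (e.2 : ℕ))) ?_ ?_ ?_ ?_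
  · intro e he
    exact List.mem_toFinset.2 (mem_filter.1 he).2
  · intro e _ e' _ h
    simp only [Prod.mk.injEq] at h
    exact Prod.ext (Fin.ext h.1) (Fin.ext h.2)
  · intro b hb
    rw [List.mem_toFinset] at hb
    obtain ⟨h1, -, h2⟩ := mem_bondsAux δ.toList 0 [] N (by simp) (by omega) b hb
    exact ⟨(⟨b.1, h1⟩, ⟨b.2, h2⟩), mem_filter.2 ⟨mem_univ _, hb⟩, rfl⟩
  · intro e _
    simp [hpos]

theorem sum_sub_of_le (pos : ℕ → ℕ) {q b : ℕ} (hqb : q ≤ b) : ∀ st : List ℕ,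
    (∀ a ∈ st, pos a ≤ q) →
      (st.map fun a => b - pos a).sum = (st.map fun a => q - pos a).sum + st.length * (b - q)
  | [], _ => by simp
  | a :: st, h => by
    have ih := sum_sub_of_le pos hqb st fun c hc => h c (by simp [hc])
    have ha := h a (by simp)
    simp only [List.map_cons, List.sum_cons, List.length_cons, ih, Nat.succ_mul]
    omega

/-- The height is the number of open bonds, each of which grows by the length of the gap crossed.
The sum over the stack accounts for the portions of the open bonds already covered at q. -/
theorem sum_bondsAux {pos : ℕ → ℕ} (hpos : Monotone pos) : ∀ (n k q : ℕ) (s : List DyckStep)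
    (st : List ℕ), s ∈ descents st.length n → (∀ a ∈ st, pos a ≤ q) → q ≤ pos k →
    ((bondsAux s k st).map fun b => pos b.2 - pos b.1).sum =
      (st.map fun a => q - pos a).sum + area st.length q s ((List.range' k n).map pos)
  | n, k, q, s, [], hs, _, _ => by
    obtain ⟨rfl, rfl⟩ := mem_descents_zero.1 hs
    simp [bondsAux, area]
  | 0, k, q, s, a :: st, hs, _, _ => by simp [descents] at hs
  | n + 1, k, q, s, a :: st, hs, hst, hq => by
    obtain ⟨c, t, rfl, ht⟩ := mem_descents_succ.1 hs
    have hk : pos k ≤ pos (k + 1) := hpos (Nat.le_succ k)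
    have hst' : ∀ b ∈ a :: st, pos b ≤ pos k := fun b hb => (hst b hb).trans hq
    have hsum := sum_sub_of_le pos hq (a :: st) hst
    have hr : (List.range' k (n + 1)).map pos = pos k :: (List.range' (k + 1) n).map pos := by
      rw [List.range'_succ, List.map_cons]
    rw [hr, area]
    cases c
    · rw [bondsAux, sum_bondsAux hpos n (k + 1) (pos k) t (k :: a :: st) ht
        (by rintro b hb; rcases List.mem_cons.1 hb with rfl | hb; · rfl
            · exact hst' b hb) hk, List.map_cons, List.sum_cons, hsum, Nat.sub_self]
      simp only [nextHeight, List.length_cons]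
      ring
    · rw [bondsAux, List.map_cons, List.sum_cons, sum_bondsAux hpos n (k + 1) (pos k) t st ht
        (fun b hb => hst' b (by simp [hb])) hk, ← add_assoc, ← add_assoc, ← hsum, List.map_cons,
        List.sum_cons]
      rfl

/-- The joint cumulants of the spins as signed sums over Dyck paths. -/
theorem jointCumulant_spin (n r : ℕ) (hr : 1 ≤ r) (β : ℝ) (i : Fin (2 * r) → Fin n)
    (hi : Monotone i) :
    jointCumulant (isingMeasure n 0 β) (fun j : Fin (2 * r) => spin (i j)) =
      (-1 : ℝ) ^ (r - 1) * ∑ δ ∈ dyckStar r,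
        (∏ k ∈ Icc 1 (2 * r - 1), (height δ k : ℝ)) * Real.tanh β ^ totalLength i δ := by
  obtain ⟨m, hm⟩ : ∃ m, 2 * r = m + 1 := ⟨2 * r - 1, by omega⟩
  -- Clamping at the last index m = 2r - 1 extends the sites to a monotone function on ℕ.
  let pos : ℕ → ℕ := fun k => i ⟨min k m, by omega⟩
  have hpos : Monotone pos := fun a b h => hi (Fin.mk_le_mk.2 (min_le_min_right m h))
  have hposi : ∀ j : Fin (2 * r), pos j = i j := fun j => by
    simp only [pos]
    congr 2
    exact Fin.ext (min_eq_left (by omega))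
  have hl : (List.finRange (2 * r)).map (fun j => (i j : ℕ)) =
      pos 0 :: (List.range' 1 m).map pos := by
    have : (fun j => (i j : ℕ)) = pos ∘ fun j : Fin (2 * r) => (j : ℕ) :=
      funext fun j => (hposi j).symm
    rw [this, ← List.map_map]
    have h2 : (List.finRange (2 * r)).map (fun j : Fin (2 * r) => (j : ℕ)) = List.range (2 * r) := by simp
    rw [h2, hm, List.range_eq_range', List.range'_succ, List.map_cons]
  rw [jointCumulant_spin_eq_excursionSum (by omega) β hi, hl, excursionSum,
    pathSum_eq_sum_descents, mul_sum]
  have hterm : ∀ δ ∈ dyckStar r, (-1 : ℝ) ^ (r - 1) *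
      ((∏ k ∈ Finset.Icc 1 (2 * r - 1), (height δ k : ℝ)) * Real.tanh β ^ totalLength i δ) =
      stepsWeight 1 δ.toList.tail *
        Real.tanh β ^ area 1 (pos 0) δ.toList.tail ((List.range' 1 m).map pos) := by
    intro δ hδ
    obtain ⟨p, hp, rfl⟩ := mem_dyckStar.1 hδ
    have hlen := p.two_mul_semilength_eq_length
    have hs : p.toList ++ [DyckStep.D] ∈ descents 1 (2 * r - 1) :=
      mem_descents_iff.2 ⟨p.toList, rfl, by omega, p.count_U_eq_count_D, p.count_D_le_count_U⟩
    rw [← mul_assoc, prod_height hr hs rfl, totalLength_eq_sum i p.nest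
      (by rw [← DyckWord.two_mul_semilength_eq_length, DyckWord.semilength_nest]; omega) pos hposi]
    -- After the initial ascent the stack holds only the bond opened at 0, still of length zero.
    have hb := sum_bondsAux hpos m 1 (pos 0) (p.toList ++ [DyckStep.D]) [0]
      (by rwa [show m = 2 * r - 1 by omega]) (by simp) (hpos zero_le_one)
    rw [List.map_singleton, List.sum_singleton, Nat.sub_self, zero_add] at hb
    congr 2
  rw [Finset.sum_congr rfl hterm, sum_dyckStar hr fun s => stepsWeight 1 s.tail *
    Real.tanh β ^ area 1 (pos 0) s.tail ((List.range' 1 m).map pos)]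
  simp [show m = 2 * r - 1 by omega]

end Excursions

end IsingCumulant

theorem mainTheorem8 (n r : ℕ) (hr : 1 ≤ r) (β : ℝ) (i : Fin (2 * r) → Fin n)
    (hi : Monotone i) :
    IsingCumulant.jointCumulant (IsingCumulant.isingMeasure n 0 β)
        (fun j : Fin (2 * r) => IsingCumulant.spin (i j)) =
      (-1 : ℝ) ^ (r - 1) *
        ∑ δ ∈ IsingCumulant.dyckStar r,
          (∏ k ∈ Finset.Icc 1 (2 * r - 1), (IsingCumulant.height δ k : ℝ)) *
            Real.tanh β ^ IsingCumulant.totalLength i δ :=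
  IsingCumulant.jointCumulant_spin n r hr β i hi
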